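/- Let $\Delta$ be a compact convex metrizable subset of a Hausdorff locally convex real topological vector space $E$, and suppose that $\Delta$ is a Choquet simplex, i.e. the cone $\{(tx,t): t\ge 0,\ x\in\Delta\}\subseteq E\times\mathbb R$ is a lattice in its own order. Let $\mathrm{Aff}(\Delta)$ be the real vector space of continuous affine functions $\Delta\to\mathbb R$, with the pointwise order, the supremum norm $\|\cdot\|_\infty$ and the constant function $1$ as unit; give $\mathbb R^m$ the coordinatewise order and the unit $(1,\dots,1)$. Then, for any finite subset $\mathcal F\subseteq\mathrm{Aff}(\Delta)$ and any $\varepsilon>0$, there exist $m\in\mathbb N$ and unital positive linear maps $\varrho:\mathrm{Aff}(\Delta)\to\mathbb R^m$ and $\theta:\mathbb R^m\to\mathrm{Aff}(\Delta)$ such that $$\|\theta(\varrho(f))-f\|_\infty<\varepsilon,\qquad f\in\mathcal F.$$ (Here $m=0$ is allowed, but it can occur only if $\Delta=\emptyset$.) -/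

import Mathlib

/-- The cone `{(t x, t) : t ≥ 0, x ∈ Δ} ⊆ E × ℝ` generated by the copy `Δ × {1}` of the convex
set `Δ`. -/
def simplexCone {E : Type*} [AddCommGroup E] [Module ℝ E] (Δ : Set E) : Set (E × ℝ) :=
  {p | ∃ t : ℝ, 0 ≤ t ∧ ∃ x ∈ Δ, p = (t • x, t)}

/-- A convex set `Δ` is a (Choquet) simplex if the cone generated by `Δ × {1}` is a lattice in its
own order, `p ≤ q` meaning `q - p ∈ simplexCone Δ`: any two elements have a least upper bound
(equivalently, the vector space spanned by the cone, ordered by the cone, is a vector lattice).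
Compactness of `Δ` is required separately. -/
structure IsChoquetSimplex {E : Type*} [AddCommGroup E] [Module ℝ E] (Δ : Set E) : Prop where
  convex : Convex ℝ Δ
  exists_lub : ∀ p ∈ simplexCone Δ, ∀ q ∈ simplexCone Δ,
    ∃ s ∈ simplexCone Δ, s - p ∈ simplexCone Δ ∧ s - q ∈ simplexCone Δ ∧
      ∀ u ∈ simplexCone Δ, u - p ∈ simplexCone Δ → u - q ∈ simplexCone Δ →
        u - s ∈ simplexCone Δ

/-- `Aff(Δ)`: the real vector space of continuous affine functions `Δ → ℝ` on a convex set `Δ`.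
For compact `Δ` it carries the supremum norm of `C(Δ, ℝ)`. -/
def Aff {E : Type*} [AddCommGroup E] [Module ℝ E] [TopologicalSpace E] (Δ : Set E) :
    Submodule ℝ C(Δ, ℝ) where
  carrier := {f | ∀ (x y z : Δ) (a b : ℝ), 0 ≤ a → 0 ≤ b → a + b = 1 →
    (z : E) = a • (x : E) + b • (y : E) → f z = a * f x + b * f y}
  zero_mem' := by
    intro x y z a b _ _ _ _
    simp
  add_mem' := by
    intro f g hf hg x y z a b ha hb hab hz
    simp only [ContinuousMap.add_apply, hf x y z a b ha hb hab hz, hg x y z a b ha hb hab hz]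
    ring
  smul_mem' := by
    intro c f hf x y z a b ha hb hab hz
    simp only [ContinuousMap.smul_apply, smul_eq_mul, hf x y z a b ha hb hab hz]
    ring

/-- The unit of `Aff(Δ)`: the constant function `1`. -/
instance Aff.instOne {E : Type*} [AddCommGroup E] [Module ℝ E] [TopologicalSpace E] (Δ : Set E) :
    One (Aff Δ) where
  one := ⟨1, by
    intro x y z a b _ _ hab _
    simpa using hab.symm⟩

/-!
Fix finitely many functions `f j` in `Aff(Δ)` and points `x i` of `Δ` such that the tuples
`(f j (x i))_j` form a finite net of the image of `Δ` under `(f j)_j`. With `ϱ` the evaluation at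
the points `x i` and `θ v = ∑ i, v i • h i`, it suffices to find nonnegative `h i` in `Aff(Δ)` with
sum `1` such that `∑ i, f j (x i) • h i` is uniformly close to `f j` for every `j`
(`IsChoquetSimplex.exists_affine_partition`).

This is a finite system of inequalities in the `h i`. Positive functionals on `Aff(Δ)` are
multiples of point evaluations (`Aff.exists_eval_of_positive`), so by Hahn-Banach an unsolvable
system has a dual certificate (`Aff.exists_eval_sum_nonpos`), which consists of elements `ν i`
and `μ j` of the cone over `Δ`, not all zero, such that `σ = ν i + ∑ j, f j (x i) • μ j` does not
depend on `i` and `σ(1) ≤ ∑ j, (μ j (f j) - ε μ j (1))`; here `f j` runs through the given functions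
and their negatives.

The simplex hypothesis excludes such a certificate. The cone is a lattice, so any two
decompositions of one of its elements have a common refinement. Consequently, a linear relation
`∑ α a = ∑ β b` with positive coefficients between elements of the cone becomes a relation between
coordinates once the two sides have been refined to a common decomposition; repeating this, any
finite system of linear relations can be made to hold coordinatewise
(`IsRieszCone.exists_decomposition_of_relations`). The certificate is thereby reduced to the case in
which all `ν i` and `μ j` are nonnegative multiples of a single point `y` of `Δ`. Choosing `i` with
`f j (x i)` close to `f j y` for every `j` then gives a contradiction.
-/

/-! ### Cones with the refinement property -/

/-- A pointed cone is a *Riesz cone* if it contains no line and two decompositions of one of its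
elements into two summands have a common refinement. -/
structure IsRieszCone {V : Type*} [AddCommGroup V] [Module ℝ V] (P : PointedCone ℝ V) : Prop where
  salient : ∀ x ∈ P, -x ∈ P → x = 0
  exists_refinement : ∀ a ∈ P, ∀ b ∈ P, ∀ c ∈ P, ∀ d ∈ P, a + b = c + d →
    ∃ p ∈ P, ∃ q ∈ P, ∃ r ∈ P, ∃ s ∈ P, a = p + q ∧ b = r + s ∧ c = p + r ∧ d = q + s

namespace IsRieszCone

variable {V : Type*} [AddCommGroup V] [Module ℝ V] {P : PointedCone ℝ V}

lemma eq_zero_of_add_eq_zero (hP : IsRieszCone P) {x y : V} (hx : x ∈ P) (hy : y ∈ P)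
    (h : x + y = 0) : x = 0 :=
  hP.salient x hx (by rwa [← eq_neg_of_add_eq_zero_right h])

lemma exists_split_sum (hP : IsRieszCone P) {κ : Type*} (J : Finset κ) (b : κ → V)
    (hb : ∀ j, b j ∈ P) (x : V) (hx : x ∈ P) (y : V) (hy : y ∈ P)
    (h : x + y = ∑ j ∈ J, b j) :
    ∃ b₁ b₂ : κ → V, (∀ j, b₁ j ∈ P) ∧ (∀ j, b₂ j ∈ P) ∧ (∀ j, b j = b₁ j + b₂ j) ∧
      x = ∑ j ∈ J, b₁ j ∧ y = ∑ j ∈ J, b₂ j := by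
  classical
  induction J using Finset.induction_on generalizing x y with
  | empty =>
    simp only [Finset.sum_empty] at h ⊢
    exact ⟨b, 0, hb, fun _ => P.zero_mem, by simp, hP.eq_zero_of_add_eq_zero hx hy h,
      hP.eq_zero_of_add_eq_zero hy hx (by rwa [add_comm])⟩
  | insert j J hj ih =>
    rw [Finset.sum_insert hj] at h
    obtain ⟨p, hp, q, hq, r, hr, s, hs, rfl, rfl, hpr, hqs⟩ :=
      hP.exists_refinement x hx y hy _ (hb j) _ (sum_mem fun i _ => hb i) h
    obtain ⟨b₁, b₂, h₁, h₂, h₁₂, rfl, rfl⟩ := ih q hq s hs hqs.symm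
    refine ⟨Function.update b₁ j p, Function.update b₂ j r, ?_, ?_, ?_, ?_, ?_⟩
    · intro i
      by_cases hi : i = j
      · subst hi; simpa using hp
      · simpa [hi] using h₁ i
    · intro i
      by_cases hi : i = j
      · subst hi; simpa using hr
      · simpa [hi] using h₂ i
    · intro i
      by_cases hi : i = j
      · subst hi; simpa using hpr
      · simpa [hi] using h₁₂ i
    all_goals
      rw [Finset.sum_insert hj, Finset.sum_update_of_notMem hj]
      simp

lemma exists_refinement_sum (hP : IsRieszCone P) {κ κ' : Type*} (I : Finset κ) (J : Finset κ')
    (a : κ → V) (b : κ' → V) (ha : ∀ i, a i ∈ P) (hb : ∀ j, b j ∈ P)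
    (h : ∑ i ∈ I, a i = ∑ j ∈ J, b j) :
    ∃ w : κ → κ' → V, (∀ i j, w i j ∈ P) ∧ (∀ i ∈ I, a i = ∑ j ∈ J, w i j) ∧
      ∀ j ∈ J, b j = ∑ i ∈ I, w i j := by
  classical
  induction I using Finset.induction_on generalizing b with
  | empty =>
    refine ⟨0, fun _ _ => P.zero_mem, by simp, fun j hj => ?_⟩
    rw [Finset.sum_empty, ← Finset.add_sum_erase J b hj] at h
    simpa using hP.eq_zero_of_add_eq_zero (hb j) (sum_mem fun i _ => hb i) h.symm
  | insert i I hi ih =>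
    rw [Finset.sum_insert hi] at h
    obtain ⟨b₁, b₂, h₁, h₂, h₁₂, hx, hy⟩ :=
      hP.exists_split_sum J b hb _ (ha i) _ (sum_mem fun i _ => ha i) h
    obtain ⟨w, hw, hwa, hwb⟩ := ih b₂ h₂ hy
    refine ⟨Function.update w i b₁, ?_, ?_, ?_⟩
    · intro k j
      by_cases hk : k = i
      · subst hk; simpa using h₁ j
      · simpa [hk] using hw k j
    · intro k hk
      by_cases hki : k = i
      · subst hki; simpa using hx
      · simpa [hki] using hwa k (Finset.mem_of_mem_insert_of_ne hk hki)
    · intro j hj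
      rw [Finset.sum_insert hi, h₁₂ j, hwb j hj]
      congr 1
      · simp
      · refine Finset.sum_congr rfl fun k hk => ?_
        rw [Function.update_of_ne (by rintro rfl; exact hi hk)]

/-- A single linear relation among elements of a Riesz cone is explained by a common
decomposition. The terms with positive and those with negative coefficient have equal sums; after
absorbing the coefficients into the vectors, the two sums have a common refinement. -/
lemma exists_decomposition_of_relation (hP : IsRieszCone P) {κ : Type} [Fintype κ] (e : κ → V)
    (he : ∀ k, e k ∈ P) (x : κ → ℝ) (hx : ∑ k, x k • e k = 0) :
    ∃ (κ' : Type) (_ : Fintype κ') (e' : κ' → V) (d : κ → κ' → ℝ),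
      (∀ l, e' l ∈ P) ∧ (∀ k l, 0 ≤ d k l) ∧ (∀ k, e k = ∑ l, d k l • e' l) ∧
      ∀ l, ∑ k, x k * d k l = 0 := by
  classical
  set I : Finset κ := Finset.univ.filter fun k => 0 < x k with hI
  set J : Finset κ := Finset.univ.filter fun k => x k < 0 with hJ
  have hsum : ∑ i ∈ I, |x i| • e i = ∑ j ∈ J, |x j| • e j := by
    have h₁ : ∑ i ∈ I, |x i| • e i = ∑ k, if 0 < x k then x k • e k else 0 := by
      rw [hI, Finset.sum_filter]
      refine Finset.sum_congr rfl fun k _ => ?_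
      split_ifs with h
      · rw [abs_of_pos h]
      · rfl
    have h₂ : ∑ j ∈ J, |x j| • e j = -∑ k, if x k < 0 then x k • e k else 0 := by
      rw [hJ, Finset.sum_filter, ← Finset.sum_neg_distrib]
      refine Finset.sum_congr rfl fun k _ => ?_
      split_ifs with h
      · rw [abs_of_neg h, neg_smul]
      · simp
    rw [h₁, h₂, eq_neg_iff_add_eq_zero, ← Finset.sum_add_distrib]
    refine (Finset.sum_congr rfl fun k _ => ?_).trans hx
    rcases lt_trichotomy (x k) 0 with h | h | h
    · simp [h, h.not_gt]
    · simp [h]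
    · simp [h, h.not_gt]
  obtain ⟨w, hw, hwI, hwJ⟩ := hP.exists_refinement_sum I J _ _
    (fun i => P.smul_mem (abs_nonneg (x i)) (he i))
    (fun j => P.smul_mem (abs_nonneg (x j)) (he j)) hsum
  have hdisj : ∀ i ∈ I, ∀ j ∈ J, i ≠ j := by
    rintro i hi j hj rfl
    simp only [hI, hJ, Finset.mem_filter, Finset.mem_univ, true_and] at hi hj
    exact hi.not_gt hj
  have hpos : ∀ i : I, 0 < x i := fun i => (Finset.mem_filter.1 i.2).2
  have hneg : ∀ j : J, x j < 0 := fun j => (Finset.mem_filter.1 j.2).2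
  -- The pieces are the entries of the refinement, together with the vectors with coefficient `0`.
  refine ⟨(I × J) ⊕ κ, inferInstance, Sum.elim (fun p => w p.1 p.2) e,
    fun k => Sum.elim
      (fun p => (if k = p.1 then |x k|⁻¹ else 0) + (if k = p.2 then |x k|⁻¹ else 0))
      (fun l => if k = l ∧ x k = 0 then 1 else 0), ?_, ?_, ?_, ?_⟩
  · rintro (p | l)
    · exact hw _ _
    · exact he l
  · rintro k (p | l)
    · simp only [Sum.elim_inl]
      positivity
    · simp only [Sum.elim_inr]
      positivity
  · intro k
    have hinv : x k ≠ 0 → e k = |x k|⁻¹ • |x k| • e k := fun h => by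
      rw [smul_smul, inv_mul_cancel₀ (abs_ne_zero.2 h), one_smul]
    simp only [Fintype.sum_sum_type, Sum.elim_inl, Sum.elim_inr, Fintype.sum_prod_type]
    rcases lt_trichotomy (x k) 0 with h | h | h
    · have hkJ : k ∈ J := by simp [hJ, h]
      have hkI : ∀ i : I, k ≠ i := fun i hi => hdisj i i.2 k hkJ hi.symm
      rw [hinv h.ne, hwJ k hkJ, Finset.smul_sum, ← Finset.sum_coe_sort I]
      have hs : ∀ i : I, ∑ j : J, ((if k = (i : κ) then |x k|⁻¹ else 0) +
          (if k = (j : κ) then |x k|⁻¹ else 0)) • w i j = |x k|⁻¹ • w i k := by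
        intro i
        rw [Finset.sum_eq_single ⟨k, hkJ⟩]
        · simp [hkI]
        · intro j _ hj
          have : k ≠ j := fun hkj => hj (Subtype.ext hkj.symm)
          simp [hkI, this]
        · simp
      rw [Finset.sum_congr rfl fun i _ => hs i]
      simp [h.ne]
    · have h₁ : ∀ i : I, k ≠ i := fun i hi => (hpos i).ne' (hi ▸ h)
      have h₂ : ∀ j : J, k ≠ j := fun j hj => (hneg j).ne (hj ▸ h)
      simp [h, h₁, h₂]
    · have hkI : k ∈ I := by simp [hI, h]
      have hkJ : ∀ j : J, k ≠ j := fun j hj => hdisj k hkI j j.2 hj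
      rw [hinv h.ne', hwI k hkI, Finset.smul_sum, ← Finset.sum_coe_sort J,
        Finset.sum_eq_single (⟨k, hkI⟩ : I)]
      · simp [hkJ, h.ne']
      · intro i _ hi
        have : k ≠ i := fun hki => hi (Subtype.ext hki.symm)
        simp [hkJ, this]
      · simp
  · rintro (⟨i, j⟩ | l)
    · have hi := hpos i
      have hj := hneg j
      simp only [Sum.elim_inl, mul_add, Finset.sum_add_distrib, mul_ite, mul_zero,
        Finset.sum_ite_eq', Finset.mem_univ, if_true, abs_of_pos hi, abs_of_neg hj]
      rw [mul_inv_cancel₀ hi.ne', inv_neg, mul_neg, mul_inv_cancel₀ hj.ne, add_neg_cancel]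
    · refine Finset.sum_eq_zero fun k _ => ?_
      by_cases h : x k = 0 <;> simp [h]

/-- Any finite system of linear relations among finitely many elements of a Riesz cone holds
coordinatewise after the elements have been written as nonnegative combinations of suitable
elements of the cone. -/
lemma exists_decomposition_of_relations (hP : IsRieszCone P) {ι τ : Type} [Fintype ι]
    (v : ι → V) (hv : ∀ g, v g ∈ P) (R : Finset τ) (r : τ → ι → ℝ)
    (hr : ∀ l ∈ R, ∑ g, r l g • v g = 0) :
    ∃ (κ : Type) (_ : Fintype κ) (e : κ → V) (c : ι → κ → ℝ),
      (∀ k, e k ∈ P) ∧ (∀ g k, 0 ≤ c g k) ∧ (∀ g, v g = ∑ k, c g k • e k) ∧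
      ∀ l ∈ R, ∀ k, ∑ g, r l g * c g k = 0 := by
  classical
  induction R using Finset.induction_on with
  | empty =>
    refine ⟨ι, inferInstance, v, fun g k => if g = k then 1 else 0, hv, ?_, by simp, by simp⟩
    intro g k
    positivity
  | insert l R hl ih =>
    obtain ⟨κ, _, e, c, he, hc, hve, hrc⟩ := ih fun l' hl' => hr l' (Finset.mem_insert_of_mem hl')
    obtain ⟨κ', _, e', d, he', hd, hed, hxd⟩ :=
      hP.exists_decomposition_of_relation e he (fun k => ∑ g, r l g * c g k) (by
        rw [← hr l (Finset.mem_insert_self l R)]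
        simp_rw [Finset.sum_smul, hve, Finset.smul_sum, smul_smul]
        exact Finset.sum_comm)
    have hswap : ∀ (s : ι → ℝ) (m : κ'), ∑ g, s g * ∑ k, c g k * d k m =
        ∑ k, (∑ g, s g * c g k) * d k m := by
      intro s m
      simp_rw [Finset.mul_sum, Finset.sum_mul, mul_assoc]
      exact Finset.sum_comm
    refine ⟨κ', inferInstance, e', fun g m => ∑ k, c g k * d k m, he', ?_, ?_, ?_⟩
    · exact fun g m => Finset.sum_nonneg fun k _ => mul_nonneg (hc g k) (hd k m)
    · intro g
      rw [hve g]
      simp_rw [Finset.sum_smul, hed, Finset.smul_sum, smul_smul]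
      exact Finset.sum_comm
    · intro l' hl' m
      rw [hswap]
      rcases Finset.mem_insert.1 hl' with rfl | hl'
      · exact hxd m
      · simp [hrc l' hl']

end IsRieszCone

/-! ### The cone over a simplex -/

section SimplexCone

variable {E : Type*} [AddCommGroup E] [Module ℝ E] {Δ : Set E}

lemma exists_smul_eq_of_convex (hΔ : Convex ℝ Δ) {x y : E} (hx : x ∈ Δ) (hy : y ∈ Δ) {s t : ℝ}
    (hs : 0 ≤ s) (ht : 0 ≤ t) : ∃ z ∈ Δ, (s + t) • z = s • x + t • y := by
  rcases (add_nonneg hs ht).eq_or_lt with h | h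
  · obtain rfl : s = 0 := by linarith
    obtain rfl : t = 0 := by linarith
    exact ⟨x, hx, by simp⟩
  · refine ⟨(s / (s + t)) • x + (t / (s + t)) • y,
      hΔ hx hy (by positivity) (by positivity) (by field_simp), ?_⟩
    rw [smul_add, smul_smul, smul_smul, mul_div_cancel₀ _ h.ne', mul_div_cancel₀ _ h.ne']

/-- The cone generated by `Δ × {1}`, for nonempty convex `Δ`, as a pointed cone. -/
def simplexPointedCone (hΔ : Convex ℝ Δ) (hne : Δ.Nonempty) : PointedCone ℝ (E × ℝ) where
  carrier := simplexCone Δ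
  zero_mem' := by
    obtain ⟨x, hx⟩ := hne
    exact ⟨0, le_rfl, x, hx, by rw [zero_smul]; rfl⟩
  add_mem' := by
    rintro _ _ ⟨s, hs, x, hx, rfl⟩ ⟨t, ht, y, hy, rfl⟩
    obtain ⟨z, hz, h⟩ := exists_smul_eq_of_convex hΔ hx hy hs ht
    exact ⟨s + t, add_nonneg hs ht, z, hz, by simp [h]⟩
  smul_mem' := by
    rintro ⟨c, hc⟩ _ ⟨t, ht, x, hx, rfl⟩
    exact ⟨c * t, mul_nonneg hc ht, x, hx, by
      ext
      · exact (mul_smul c t x).symm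
      · rfl⟩

/-- The cone of a Choquet simplex is a Riesz cone: if `a + b = c + d`, then the infimum
`a + c - a ⊔ c` of `a` and `c` is the first entry of a common refinement. -/
lemma IsChoquetSimplex.isRieszCone (hΔ : IsChoquetSimplex Δ) (hne : Δ.Nonempty) :
    IsRieszCone (simplexPointedCone hΔ.convex hne) where
  salient := by
    rintro _ ⟨t, ht, x, hx, rfl⟩ ⟨s, hs, y, hy, h⟩
    have h2 : -t = s := congrArg Prod.snd h
    obtain rfl : t = 0 := by linarith
    simp
  exists_refinement := by
    intro a ha b hb c hc d hd h
    obtain ⟨s, -, hsa, hsc, hs⟩ := hΔ.exists_lub a ha c hc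
    have hd' : d = a + b - c := by rw [h]; abel
    refine ⟨a + c - s, hs (a + c) (add_mem ha hc) ?_ ?_, s - c, hsc, s - a, hsa,
      a + b - s, hs (a + b) (add_mem ha hb) ?_ ?_, ?_, ?_, ?_, ?_⟩
    · simpa using! hc
    · simpa using! ha
    · simpa using! hb
    · rw [h, add_sub_cancel_left]; exact hd
    all_goals try rw [hd']
    all_goals abel

end SimplexCone

/-! ### Positive functionals on `Aff(Δ)` -/

section Aff

variable {E : Type*} [AddCommGroup E] [Module ℝ E] [TopologicalSpace E] {Δ : Set E}

@[simp] lemma Aff.one_apply (x : Δ) : ((1 : Aff Δ) : C(Δ, ℝ)) x = 1 := rfl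

/-- The evaluation `g ↦ g x` on `Aff(Δ)`. -/
def Aff.eval (x : Δ) : Aff Δ →ₗ[ℝ] ℝ where
  toFun g := (g : C(Δ, ℝ)) x
  map_add' _ _ := rfl
  map_smul' _ _ := rfl

@[simp] lemma Aff.eval_apply (x : Δ) (g : Aff Δ) : Aff.eval x g = (g : C(Δ, ℝ)) x := rfl

@[simp] lemma Aff.sum_apply {ι : Type*} (s : Finset ι) (g : ι → Aff Δ) (x : Δ) :
    ((∑ i ∈ s, g i : Aff Δ) : C(Δ, ℝ)) x = ∑ i ∈ s, (g i : C(Δ, ℝ)) x :=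
  map_sum (Aff.eval x) g s

/-- A continuous affine function on `Δ` extends to a linear function on `simplexCone Δ`; stated
for finite nonnegative combinations of points `s k • (y k, 1)` of the cone. -/
lemma Aff.mul_apply_eq_sum (hΔ : Convex ℝ Δ) (f : Aff Δ) {κ : Type*} (K : Finset κ) (s : κ → ℝ)
    (hs : ∀ k ∈ K, 0 ≤ s k) (y : κ → Δ) (t : ℝ) (x : Δ)
    (hx : t • (x : E) = ∑ k ∈ K, s k • (y k : E)) (ht : t = ∑ k ∈ K, s k) :
    t * (f : C(Δ, ℝ)) x = ∑ k ∈ K, s k * (f : C(Δ, ℝ)) (y k) := by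
  classical
  induction K using Finset.induction_on generalizing t x with
  | empty => simp_all
  | insert k K hk ih =>
    rw [Finset.sum_insert hk] at hx ht ⊢
    have hsK : ∀ i ∈ K, 0 ≤ s i := fun i hi => hs i (Finset.mem_insert_of_mem hi)
    have hsk : 0 ≤ s k := hs k (Finset.mem_insert_self k K)
    have hS : 0 ≤ ∑ i ∈ K, s i := Finset.sum_nonneg hsK
    rcases hS.eq_or_lt with h | h
    · have h0 : ∀ i ∈ K, s i = 0 := (Finset.sum_eq_zero_iff_of_nonneg hsK).1 h.symm
      rw [Finset.sum_eq_zero fun i hi => by rw [h0 i hi, zero_smul]] at hx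
      rw [Finset.sum_eq_zero fun i hi => by rw [h0 i hi, zero_mul]]
      rw [← h, add_zero] at ht
      subst ht
      rcases hsk.eq_or_lt with h' | h'
      · simp [← h']
      · rw [add_zero] at hx
        rw [add_zero, Subtype.ext (smul_right_injective E h'.ne' hx)]
    · -- The barycentre `z` of the points with index in `K` lies on the segment below.
      let z : Δ := ⟨∑ i ∈ K, (s i / ∑ i ∈ K, s i) • (y i : E),
        hΔ.sum_mem (fun i hi => div_nonneg (hsK i hi) hS)
          (by rw [← Finset.sum_div, div_self h.ne']) fun i _ => (y i).2⟩
      have hz : (∑ i ∈ K, s i) • (z : E) = ∑ i ∈ K, s i • (y i : E) := by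
        simp only [z, Finset.smul_sum, smul_smul]
        exact Finset.sum_congr rfl fun i _ => by rw [mul_div_cancel₀ _ h.ne']
      rw [← ih hsK _ z hz rfl]
      have htpos : 0 < t := by linarith
      have hxz : (x : E) = (s k / t) • (y k : E) + ((∑ i ∈ K, s i) / t) • (z : E) := by
        apply smul_right_injective E htpos.ne'
        simp only [smul_add, smul_smul, mul_div_cancel₀ _ htpos.ne', hx, hz]
      rw [f.2 (y k) z x _ _ (by positivity) (by positivity)
        (by rw [← add_div, ← ht, div_self htpos.ne']) hxz]
      field_simp

/-- A positive functional on `Aff(Δ)`, for compact convex `Δ`, is a multiple of a point evaluation.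
By compactness it suffices to find a point representing the functional on finitely many
functions; if there were none, then some linear combination of these functions would separate the
value of the functional from the values at the points of `Δ`. -/
lemma Aff.exists_eval_of_positive [CompactSpace Δ] [Nonempty Δ] (hΔ : Convex ℝ Δ)
    (φ : Aff Δ →ₗ[ℝ] ℝ)
    (hφ : ∀ g : Aff Δ, (∀ x, 0 ≤ (g : C(Δ, ℝ)) x) → 0 ≤ φ g) :
    ∃ x : Δ, ∀ g : Aff Δ, φ g = φ 1 * (g : C(Δ, ℝ)) x := by
  classical
  have h1 : 0 ≤ φ 1 := hφ 1 fun x => by simp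
  have hmono : ∀ (g : Aff Δ) (u : ℝ), (∀ x, (g : C(Δ, ℝ)) x ≤ u) → φ g ≤ u * φ 1 := by
    intro g u hu
    have := hφ (u • 1 - g) fun x => by
      have := hu x
      change 0 ≤ u * 1 - (g : C(Δ, ℝ)) x
      linarith
    simpa using this
  have hclosed : ∀ g : Aff Δ, IsClosed {x : Δ | φ g = φ 1 * (g : C(Δ, ℝ)) x} := fun g =>
    isClosed_eq continuous_const (continuous_const.mul (g : C(Δ, ℝ)).continuous)
  have hfin : ∀ S : Finset (Aff Δ),
      (⋂ g ∈ S, {x : Δ | φ g = φ 1 * (g : C(Δ, ℝ)) x}).Nonempty := by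
    intro S
    by_contra hS
    let ev : Δ → (S → ℝ) := fun x g => φ 1 * ((g : Aff Δ) : C(Δ, ℝ)) x
    have hev : Continuous ev :=
      continuous_pi fun g => continuous_const.mul ((g : Aff Δ) : C(Δ, ℝ)).continuous
    have hconv : Convex ℝ (Set.range ev) := by
      rintro _ ⟨x, rfl⟩ _ ⟨y, rfl⟩ a b ha hb hab
      refine ⟨⟨a • (x : E) + b • (y : E), hΔ x.2 y.2 ha hb hab⟩, ?_⟩
      funext g
      simp only [ev, Pi.add_apply, Pi.smul_apply, smul_eq_mul]
      rw [(g : Aff Δ).2 x y _ a b ha hb hab rfl]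
      ring
    have hnot : (fun g : S => φ g) ∉ Set.range ev := by
      rintro ⟨x, hx⟩
      refine hS ⟨x, ?_⟩
      simp only [Set.mem_iInter]
      exact fun g hg => (congrFun hx ⟨g, hg⟩).symm
    obtain ⟨ℓ, u, hℓ, hu⟩ :=
      geometric_hahn_banach_closed_point hconv (isCompact_range hev).isClosed hnot
    have hℓsum : ∀ v : S → ℝ, ℓ v = ∑ g, v g * ℓ (Pi.single g 1) := by
      intro v
      conv_lhs => rw [← Finset.univ_sum_single v]
      rw [map_sum]
      refine Finset.sum_congr rfl fun g _ => ?_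
      rw [← smul_eq_mul, ← map_smul, ← Pi.single_smul, smul_eq_mul, mul_one]
    let G : Aff Δ := ∑ g : S, ℓ (Pi.single g 1) • (g : Aff Δ)
    have hG : ∀ x, φ 1 * (G : C(Δ, ℝ)) x = ℓ (ev x) := by
      intro x
      rw [hℓsum, ← Aff.eval_apply, map_sum, Finset.mul_sum]
      refine Finset.sum_congr rfl fun g _ => ?_
      simp only [map_smul, Aff.eval_apply, smul_eq_mul, ev]
      ring
    have hφG : φ G = ℓ (fun g : S => φ g) := by
      rw [hℓsum, map_sum]
      exact Finset.sum_congr rfl fun g _ => by rw [map_smul, smul_eq_mul, mul_comm]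
    rcases h1.eq_or_lt with h0 | h0
    · -- A positive functional that vanishes at `1` is zero.
      obtain ⟨x⟩ := ‹Nonempty Δ›
      have hφ0 : ∀ g, φ g = 0 := by
        have hle : ∀ g, φ g ≤ 0 := fun g => by
          simpa [← h0] using hmono g ‖(g : C(Δ, ℝ))‖ fun x =>
            (le_abs_self _).trans ((g : C(Δ, ℝ)).norm_coe_le_norm x)
        intro g
        have := hle (-g)
        rw [map_neg] at this
        exact le_antisymm (hle g) (by linarith)
      have := hℓ _ ⟨x, rfl⟩
      rw [← hG, ← h0, zero_mul] at this
      rw [← hφG, hφ0] at hu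
      exact this.not_gt hu
    · have := hmono G (u / φ 1) fun x => by
        rw [le_div_iff₀ h0, mul_comm, hG]
        exact (hℓ _ ⟨x, rfl⟩).le
      rw [div_mul_cancel₀ _ h0.ne', hφG] at this
      exact this.not_gt hu
  obtain ⟨x, hx⟩ := CompactSpace.iInter_nonempty hclosed hfin
  exact ⟨x, fun g => Set.mem_iInter.1 hx g⟩

/-- Theorem of the alternative for `Aff(Δ)`: if a nonempty convex set of tuples of continuous
affine functions contains no tuple all of whose entries are strictly positive, then some nonzero
nonnegative combination of point evaluations, one in each entry, is `≤ 0` on the set. -/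
lemma Aff.exists_eval_sum_nonpos [CompactSpace Δ] [Nonempty Δ] (hΔ : Convex ℝ Δ) {ι : Type*}
    [Fintype ι] (W : Set (ι → Aff Δ)) (hW : Convex ℝ W) (hne : W.Nonempty)
    (hpos : ∀ w ∈ W, ∃ i x, (w i : C(Δ, ℝ)) x ≤ 0) :
    ∃ (t : ι → ℝ) (x : ι → Δ), (∀ i, 0 ≤ t i) ∧ (∃ i, 0 < t i) ∧
      ∀ w ∈ W, ∑ i, t i * (w i : C(Δ, ℝ)) (x i) ≤ 0 := by
  classical
  let U : Set (ι → Aff Δ) := {w | ∀ i x, 0 < (w i : C(Δ, ℝ)) x}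
  have hUconv : Convex ℝ U := by
    intro v hv w hw a b ha hb hab i x
    have h₁ := hv i x
    have h₂ := hw i x
    change 0 < a * (v i : C(Δ, ℝ)) x + b * (w i : C(Δ, ℝ)) x
    rcases ha.eq_or_lt with rfl | ha
    · obtain rfl : b = 1 := by linarith
      simpa using h₂
    · positivity
  have hUopen : IsOpen U := by
    have : U = ⋂ i, (fun w : ι → Aff Δ => (w i : C(Δ, ℝ))) ⁻¹'
        {g : C(Δ, ℝ) | Set.MapsTo g Set.univ (Set.Ioi 0)} := by
      ext w
      simp [U, Set.MapsTo]
    rw [this]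
    refine isOpen_iInter_of_finite fun i => IsOpen.preimage ?_
      (ContinuousMap.isOpen_setOfPred_mapsTo isCompact_univ isOpen_Ioi)
    exact continuous_subtype_val.comp (continuous_apply i)
  have hdisj : Disjoint U W := by
    rw [Set.disjoint_left]
    intro w hwU hwW
    obtain ⟨i, x, h⟩ := hpos w hwW
    exact h.not_gt (hwU i x)
  obtain ⟨ψ, u, hψU, hψW⟩ := geometric_hahn_banach_open hUconv hUopen hW hdisj
  have hone : (1 : ι → Aff Δ) ∈ U := fun i x => by simp
  have hcone : ∀ w ∈ U, ∀ s : ℝ, 0 < s → s • w ∈ U := fun w hw s hs i x =>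
    mul_pos hs (hw i x)
  -- As `U` is a cone, the separating functional is `≤ 0` on it and the separating level is `≥ 0`.
  have hψU0 : ∀ w ∈ U, ψ w ≤ 0 := by
    intro w hw
    by_contra! h
    have := hψU _ (hcone w hw ((|u| + 1) / ψ w) (by positivity))
    rw [map_smul, smul_eq_mul, div_mul_cancel₀ _ h.ne'] at this
    linarith [le_abs_self u]
  have hu0 : 0 ≤ u := by
    by_contra! h
    rcases (hψU0 _ hone).eq_or_lt with h0 | h0
    · linarith [hψU _ hone]
    · have := hψU _ (hcone _ hone (u / ψ 1) (div_pos_of_neg_of_neg h h0))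
      rw [map_smul, smul_eq_mul, div_mul_cancel₀ _ h0.ne] at this
      exact this.ne rfl
  have hψ0 : ∀ w : ι → Aff Δ, (∀ i x, 0 ≤ (w i : C(Δ, ℝ)) x) → ψ w ≤ 0 := by
    intro w hw
    by_contra! h
    -- A positive multiple of `1` moves `w` into `U`; this one is too small to make `ψ` nonpositive.
    have hmem : w + (ψ w / (2 * (|ψ 1| + 1))) • (1 : ι → Aff Δ) ∈ U := fun i x => by
      have := hw i x
      change 0 < (w i : C(Δ, ℝ)) x + (ψ w / (2 * (|ψ 1| + 1))) * 1
      positivity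
    have := hψU0 _ hmem
    rw [map_add, map_smul, smul_eq_mul] at this
    have h₂ : -(ψ w / (2 * (|ψ 1| + 1)) * ψ 1) ≤ ψ w / 2 := by
      rw [div_mul_eq_mul_div, ← neg_div, div_le_div_iff₀ (by positivity) (by positivity)]
      nlinarith [neg_abs_le (ψ 1), abs_nonneg (ψ 1)]
    linarith
  have hψsum : ∀ w, ψ w = ∑ i, ψ (Pi.single i (w i)) := fun w => by
    rw [← map_sum, Finset.univ_sum_single]
  let φ : ι → Aff Δ →ₗ[ℝ] ℝ := fun i => -(ψ.toLinearMap ∘ₗ LinearMap.single ℝ (fun _ => Aff Δ) i)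
  have hφ : ∀ i g, φ i g = -ψ (Pi.single i g) := fun i g => rfl
  have hφpos : ∀ i (g : Aff Δ), (∀ x, 0 ≤ (g : C(Δ, ℝ)) x) → 0 ≤ φ i g := by
    intro i g hg
    rw [hφ, neg_nonneg]
    refine hψ0 _ fun j x => ?_
    by_cases hj : j = i
    · subst hj; simpa using hg x
    · simp [hj]
  choose x hx using fun i => Aff.exists_eval_of_positive hΔ (φ i) (hφpos i)
  have hsum : ∀ w, ∑ i, φ i 1 * (w i : C(Δ, ℝ)) (x i) = -ψ w := fun w => by
    rw [hψsum, ← Finset.sum_neg_distrib]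
    exact Finset.sum_congr rfl fun i _ => by rw [← hx, hφ]
  have hnn : ∀ i, 0 ≤ φ i 1 := fun i => hφpos i 1 fun x => by simp
  refine ⟨fun i => φ i 1, x, hnn, ?_, fun w hw => ?_⟩
  · by_contra! h
    have hzero : ∀ w, ψ w = 0 := fun w => by
      rw [← neg_eq_zero, ← hsum]
      exact Finset.sum_eq_zero fun i _ => by rw [le_antisymm (h i) (hnn i), zero_mul]
    obtain ⟨w, hw⟩ := hne
    have h₁ := hψU _ hone
    have h₂ := hψW w hw
    rw [hzero] at h₁ h₂
    linarith
  · rw [hsum]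
    linarith [hψW w hw]

end Aff

/-! ### Affine partitions of unity -/

section Approximation

variable {E : Type*} [AddCommGroup E] [Module ℝ E] [TopologicalSpace E] {Δ : Set E}

/-- The restriction of a continuous linear functional to `Δ`. -/
def Aff.ofStrongDual (Δ : Set E) (ℓ : StrongDual ℝ E) : Aff Δ :=
  ⟨⟨fun x => ℓ x, ℓ.continuous.comp continuous_subtype_val⟩, by
    intro x y z a b _ _ _ h
    simp [h]⟩

/-- Points of the cone over `Δ` that satisfy a linear relation as functionals on `Aff(Δ)` satisfy
it as vectors, because continuous linear functionals separate the points of `E`. -/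
lemma Aff.sum_smul_eq_zero [IsTopologicalAddGroup E] [ContinuousSMul ℝ E] [LocallyConvexSpace ℝ E]
    [T2Space E] {ι : Type*} [Fintype ι] (r t : ι → ℝ) (p : ι → Δ)
    (h : ∀ g : Aff Δ, ∑ i, r i * (t i * (g : C(Δ, ℝ)) (p i)) = 0) :
    ∑ i, r i • ((t i • (p i : E), t i) : E × ℝ) = 0 := by
  ext
  · rw [Prod.fst_sum, Prod.fst_zero]
    by_contra hne
    obtain ⟨ℓ, hℓ⟩ := geometric_hahn_banach_point_point (E := E) hne
    refine hℓ.ne ?_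
    rw [map_sum, map_zero, ← h (Aff.ofStrongDual Δ ℓ)]
    exact Finset.sum_congr rfl fun i _ => by simp [Aff.ofStrongDual]
  · rw [Prod.snd_sum, Prod.snd_zero, ← h 1]
    exact Finset.sum_congr rfl fun i _ => by simp

/-- An affine partition of unity subordinate, in the approximate sense, to a finite `δ`-net of the
image of `Δ` under `(f j)_j`. If there is none, then the theorem of the alternative yields points
of the cone whose linear relations, read off in the coordinates of a common decomposition,
contradict the net condition at the points occurring in that decomposition. -/
lemma IsChoquetSimplex.exists_affine_partition [IsTopologicalAddGroup E] [ContinuousSMul ℝ E]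
    [LocallyConvexSpace ℝ E] [T2Space E] [CompactSpace Δ] [Nonempty Δ] (hΔ : IsChoquetSimplex Δ)
    {m : ℕ} {J : Type} [Fintype J] (x : Fin m → Δ) (f : J → Aff Δ) {δ ε : ℝ} (hδε : δ < ε)
    (hnet : ∀ y : Δ, ∃ i, ∀ j, (f j : C(Δ, ℝ)) y - δ ≤ (f j : C(Δ, ℝ)) (x i)) :
    ∃ h : Fin m → Aff Δ, (∀ i y, 0 ≤ (h i : C(Δ, ℝ)) y) ∧ ∑ i, h i = 1 ∧
      ∀ j y, (f j : C(Δ, ℝ)) y <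
        ∑ i, (f j : C(Δ, ℝ)) (x i) * (h i : C(Δ, ℝ)) y + ε := by
  classical
  by_contra H
  obtain ⟨i₀, -⟩ := hnet (Classical.arbitrary Δ)
  let D : J → (Fin m → Aff Δ) → Aff Δ := fun j h =>
    ∑ i, (f j : C(Δ, ℝ)) (x i) • h i - f j + ε • 1
  have hD : ∀ j h y, (D j h : C(Δ, ℝ)) y =
      ∑ i, (f j : C(Δ, ℝ)) (x i) * (h i : C(Δ, ℝ)) y - (f j : C(Δ, ℝ)) y + ε := by
    intro j h y
    simp only [D, ← Aff.eval_apply y, map_add, map_sub, map_sum, map_smul, smul_eq_mul]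
    simp
  let W : Set (Fin m ⊕ J → Aff Δ) :=
    {w | ∃ h : Fin m → Aff Δ, ∑ i, h i = 1 ∧ w = Sum.elim h fun j => D j h}
  have hWconv : Convex ℝ W := by
    rintro _ ⟨h, hh, rfl⟩ _ ⟨h', hh', rfl⟩ a b ha hb hab
    refine ⟨a • h + b • h', ?_, ?_⟩
    · simp only [Pi.add_apply, Pi.smul_apply, Finset.sum_add_distrib, ← Finset.smul_sum, hh, hh',
        ← add_smul, hab, one_smul]
    · funext i
      rcases i with i | j
      · rfl
      · ext y
        change a * (D j h : C(Δ, ℝ)) y + b * (D j h' : C(Δ, ℝ)) y =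
          (D j (a • h + b • h') : C(Δ, ℝ)) y
        have hs : ∀ i, (((a • h + b • h') i : Aff Δ) : C(Δ, ℝ)) y =
          a * (h i : C(Δ, ℝ)) y + b * (h' i : C(Δ, ℝ)) y := fun i => rfl
        simp only [hD, hs, mul_add, Finset.sum_add_distrib, mul_left_comm _ a, mul_left_comm _ b,
          ← Finset.mul_sum]
        linear_combination (ε - (f j : C(Δ, ℝ)) y) * hab
  have hsingle : ∑ i, (Pi.single i₀ 1 : Fin m → Aff Δ) i = 1 := by simp
  obtain ⟨t, p, ht, htpos, htW⟩ := Aff.exists_eval_sum_nonpos hΔ.convex W hWconv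
    ⟨_, _, hsingle, rfl⟩ (by
      rintro _ ⟨h, hh, rfl⟩
      by_contra! hpos
      refine H ⟨h, fun i y => (hpos (Sum.inl i) y).le, hh, fun j y => ?_⟩
      have := hpos (Sum.inr j) y
      rw [Sum.elim_inr, hD] at this
      linarith)
  -- `T i` is the total coefficient with which the entry `h i` of a partition enters.
  let T : Fin m → Aff Δ →ₗ[ℝ] ℝ := fun i => t (Sum.inl i) • Aff.eval (p (Sum.inl i)) +
    ∑ j, ((f j : C(Δ, ℝ)) (x i) * t (Sum.inr j)) • Aff.eval (p (Sum.inr j))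
  have hT : ∀ i g, T i g = t (Sum.inl i) * (g : C(Δ, ℝ)) (p (Sum.inl i)) +
      ∑ j, (f j : C(Δ, ℝ)) (x i) * t (Sum.inr j) * (g : C(Δ, ℝ)) (p (Sum.inr j)) := by
    intro i g
    simp [T, LinearMap.sum_apply]
  set C : ℝ := ∑ j, t (Sum.inr j) * ((f j : C(Δ, ℝ)) (p (Sum.inr j)) - ε) with hC
  have hQ : ∀ h : Fin m → Aff Δ, ∑ i, h i = 1 → ∑ i, T i (h i) ≤ C := by
    intro h hh
    have := htW _ ⟨h, hh, rfl⟩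
    simp only [Fintype.sum_sum_type, Sum.elim_inl, Sum.elim_inr, hD] at this
    simp only [hT, Finset.sum_add_distrib]
    rw [Finset.sum_comm (γ := Fin m), hC, ← sub_nonpos, add_sub_assoc, ← Finset.sum_sub_distrib]
    refine le_of_eq_of_le ?_ this
    congr 1
    refine Finset.sum_congr rfl fun j _ => ?_
    simp only [mul_add, mul_sub, Finset.mul_sum]
    rw [sub_sub_eq_add_sub, sub_add_eq_add_sub]
    congr 2
    exact Finset.sum_congr rfl fun i _ => by ring
  have hQ₀ : T i₀ 1 ≤ C := by
    have := hQ _ hsingle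
    rwa [Finset.sum_eq_single i₀ (fun i _ hi => by simp [hi]) (by simp), Pi.single_eq_same] at this
  -- Moving mass between two entries of a partition must not change the value.
  have hTT : ∀ i i' g, T i g = T i' g := by
    intro i i' g
    have key : ∀ c : ℝ, T i₀ 1 + c * (T i g - T i' g) ≤ C := by
      intro c
      have := hQ (Pi.single i₀ 1 + Pi.single i (c • g) - Pi.single i' (c • g)) (by
        simp [Finset.sum_add_distrib, Finset.sum_sub_distrib])
      simp only [Pi.add_apply, Pi.sub_apply, map_add, map_sub, Finset.sum_add_distrib,
        Finset.sum_sub_distrib] at this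
      have hs : ∀ (k : Fin m) (g' : Aff Δ), ∑ l, T l ((Pi.single k g' : Fin m → Aff Δ) l) =
          T k g' := fun k g' => by
        rw [Finset.sum_eq_single k (fun l _ hl => by simp [hl]) (by simp), Pi.single_eq_same]
      rw [hs, hs, hs, map_smul, map_smul, smul_eq_mul, smul_eq_mul] at this
      linarith
    by_contra hne
    have hne' : T i g - T i' g ≠ 0 := sub_ne_zero.2 hne
    have := key ((C - T i₀ 1 + 1) / (T i g - T i' g))
    rw [div_mul_cancel₀ _ hne'] at this
    linarith
  have hΔne : Δ.Nonempty := Set.nonempty_coe_sort.1 ‹_›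
  obtain ⟨κ, _, e, c, he, hc, hve, hrc⟩ :=
    (hΔ.isRieszCone hΔne).exists_decomposition_of_relations
      (fun i => ((t i • (p i : E), t i) : E × ℝ)) (fun i => ⟨t i, ht i, p i, (p i).2, rfl⟩)
      (Finset.univ : Finset (Fin m × Fin m))
      (fun l => Sum.elim (fun i => (if i = l.1 then 1 else 0) - if i = l.2 then 1 else 0)
        fun j => (f j : C(Δ, ℝ)) (x l.1) - (f j : C(Δ, ℝ)) (x l.2)) (by
        rintro ⟨i, i'⟩ -
        refine Aff.sum_smul_eq_zero _ t p fun g => ?_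
        have := hTT i i' g
        rw [hT, hT] at this
        simp only [Fintype.sum_sum_type, Sum.elim_inl, Sum.elim_inr, sub_mul, ite_mul, one_mul,
          zero_mul, Finset.sum_sub_distrib, Finset.sum_ite_eq',
          Finset.mem_univ, if_true]
        simp only [← mul_assoc]
        linarith)
  choose s hs y hy hey using he
  have hval : ∀ i (g : Aff Δ), t i * (g : C(Δ, ℝ)) (p i) =
      ∑ k, c i k * s k * (g : C(Δ, ℝ)) ⟨y k, hy k⟩ := by
    intro i g
    have h₁ := congrArg Prod.fst (hve i)
    have h₂ := congrArg Prod.snd (hve i)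
    simp only [hey, Prod.fst_sum, Prod.snd_sum, Prod.smul_mk, smul_smul, smul_eq_mul] at h₁ h₂
    exact Aff.mul_apply_eq_sum hΔ.convex g _ (fun k => c i k * s k)
      (fun k _ => mul_nonneg (hc i k) (hs k)) (fun k => ⟨y k, hy k⟩) _ _ h₁ h₂
  have hval1 : ∀ i, t i = ∑ k, c i k * s k := fun i => by simpa using hval i 1
  have hrel : ∀ i i' k, c (Sum.inl i) k + ∑ j, (f j : C(Δ, ℝ)) (x i) * c (Sum.inr j) k =
      c (Sum.inl i') k + ∑ j, (f j : C(Δ, ℝ)) (x i') * c (Sum.inr j) k := by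
    intro i i' k
    have := hrc (i, i') (Finset.mem_univ _) k
    simp only [Fintype.sum_sum_type, Sum.elim_inl, Sum.elim_inr, sub_mul, ite_mul, one_mul,
      zero_mul, Finset.sum_sub_distrib, Finset.sum_ite_eq',
      Finset.mem_univ, if_true] at this
    linarith
  -- `B k` is the contribution of the `k`-th piece of the decomposition to `T i₀ 1 - C`.
  let B : κ → ℝ := fun k => c (Sum.inl i₀) k + ∑ j, (f j : C(Δ, ℝ)) (x i₀) * c (Sum.inr j) k -
    ∑ j, c (Sum.inr j) k * ((f j : C(Δ, ℝ)) ⟨y k, hy k⟩ - ε)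
  have hBsum : ∑ k, s k * B k = T i₀ 1 - C := by
    have hC' : C = ∑ j, ∑ k, s k * (c (Sum.inr j) k * ((f j : C(Δ, ℝ)) ⟨y k, hy k⟩ - ε)) := by
      rw [hC]
      refine Finset.sum_congr rfl fun j _ => ?_
      rw [mul_sub, hval, hval1, Finset.sum_mul, ← Finset.sum_sub_distrib]
      exact Finset.sum_congr rfl fun k _ => by ring
    have hT' : T i₀ 1 = ∑ k, s k * c (Sum.inl i₀) k +
        ∑ j, ∑ k, s k * ((f j : C(Δ, ℝ)) (x i₀) * c (Sum.inr j) k) := by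
      rw [hT]
      simp only [Aff.one_apply, mul_one]
      congr 1
      · rw [hval1]
        exact Finset.sum_congr rfl fun k _ => mul_comm _ _
      · refine Finset.sum_congr rfl fun j _ => ?_
        rw [hval1, Finset.mul_sum]
        exact Finset.sum_congr rfl fun k _ => by ring
    rw [hC', hT', Finset.sum_comm (γ := J), Finset.sum_comm (γ := J), ← Finset.sum_add_distrib,
      ← Finset.sum_sub_distrib]
    refine Finset.sum_congr rfl fun k _ => ?_
    simp only [B, mul_sub, mul_add, Finset.mul_sum]
  have hB : ∀ k, ∃ i, c (Sum.inl i) k + (ε - δ) * ∑ j, c (Sum.inr j) k ≤ B k := by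
    intro k
    obtain ⟨i, hi⟩ := hnet ⟨y k, hy k⟩
    refine ⟨i, ?_⟩
    simp only [B]
    rw [hrel i₀ i k, add_sub_assoc, ← Finset.sum_sub_distrib, Finset.mul_sum]
    gcongr with j
    nlinarith [hi j, hc (Sum.inr j) k]
  have hJnn : ∀ k, 0 ≤ ∑ j, c (Sum.inr j) k := fun k => Finset.sum_nonneg fun j _ => hc _ k
  have hBnn : ∀ k, 0 ≤ B k := fun k => by
    obtain ⟨i, hi⟩ := hB k
    nlinarith [hc (Sum.inl i) k, hJnn k]
  have hzero : ∀ k, s k * B k = 0 := by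
    have hle : ∑ k, s k * B k ≤ 0 := by rw [hBsum]; linarith
    have hnn : ∀ k ∈ Finset.univ, 0 ≤ s k * B k := fun k _ => mul_nonneg (hs k) (hBnn k)
    exact fun k => (Finset.sum_eq_zero_iff_of_nonneg hnn).1
      (le_antisymm hle (Finset.sum_nonneg hnn)) k (Finset.mem_univ k)
  -- Hence every piece has weight zero or does not occur, so that all points are zero.
  have hall : ∀ i k, c i k * s k = 0 := by
    intro i k
    rcases mul_eq_zero.1 (hzero k) with h | h
    · rw [h, mul_zero]
    · obtain ⟨i₁, hi₁⟩ := hB k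
      have hi₁' := hc (Sum.inl i₁) k
      have hJ0 : ∑ j, c (Sum.inr j) k = 0 := by
        have := hJnn k
        nlinarith
      have hcJ : ∀ j, c (Sum.inr j) k = 0 := fun j =>
        (Finset.sum_eq_zero_iff_of_nonneg fun j _ => hc (Sum.inr j) k).1 hJ0 j (Finset.mem_univ j)
      have hcI : ∀ i, c (Sum.inl i) k = 0 := fun i => by
        have := hrel i i₁ k
        simp only [hcJ, mul_zero, Finset.sum_const_zero, add_zero] at this
        rw [hJ0, h] at hi₁
        linarith
      rcases i with i | j
      · rw [hcI, zero_mul]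
      · rw [hcJ, zero_mul]
  obtain ⟨i, hi⟩ := htpos
  rw [hval1, Finset.sum_eq_zero fun k _ => hall i k] at hi
  exact hi.ne rfl

/-- The image of the compact set `Δ` under finitely many continuous functions has a finite net. -/
lemma exists_finite_net [CompactSpace Δ] {J : Type*} [Finite J] (f : J → Aff Δ) {δ : ℝ}
    (hδ : 0 < δ) :
    ∃ (m : ℕ) (x : Fin m → Δ), ∀ y : Δ, ∃ i, ∀ j,
      |(f j : C(Δ, ℝ)) y - (f j : C(Δ, ℝ)) (x i)| < δ := by
  obtain ⟨S, -, hS⟩ := (isCompact_univ (X := Δ)).elim_nhds_subcover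
    (fun z => {y | ∀ j, |(f j : C(Δ, ℝ)) y - (f j : C(Δ, ℝ)) z| < δ}) fun z _ => by
      refine IsOpen.mem_nhds ?_ (by simpa using fun _ => hδ)
      simp only [Set.ofPred_forall]
      exact isOpen_iInter_of_finite fun j => isOpen_lt (by fun_prop) continuous_const
  refine ⟨S.card, fun i => S.equivFin.symm i, fun y => ?_⟩
  obtain ⟨z, hz, hy⟩ := Set.mem_iUnion₂.1 (hS (Set.mem_univ y))
  exact ⟨S.equivFin ⟨z, hz⟩, by simpa using hy⟩

end Approximation

theorem mainTheorem5 {E : Type*} [AddCommGroup E] [Module ℝ E] [TopologicalSpace E]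
    [IsTopologicalAddGroup E] [ContinuousSMul ℝ E] [LocallyConvexSpace ℝ E] [T2Space E]
    (Δ : Set E) [CompactSpace Δ] [TopologicalSpace.MetrizableSpace Δ]
    (hΔ : IsChoquetSimplex Δ)
    (F : Set (Aff Δ)) (hF : F.Finite) (ε : ℝ) (hε : 0 < ε) :
    ∃ (m : ℕ) (ρ : Aff Δ →ₗ[ℝ] (Fin m → ℝ)) (θ : (Fin m → ℝ) →ₗ[ℝ] Aff Δ),
      (ρ 1 = 1 ∧ ∀ f : Aff Δ, (∀ x : Δ, 0 ≤ (f : C(Δ, ℝ)) x) → ∀ i, 0 ≤ ρ f i) ∧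
      (θ 1 = 1 ∧ ∀ v : Fin m → ℝ, (∀ i, 0 ≤ v i) → ∀ x : Δ, 0 ≤ (θ v : C(Δ, ℝ)) x) ∧
      ∀ f ∈ F, ‖θ (ρ f) - f‖ < ε := by
  rcases isEmpty_or_nonempty Δ with hempty | hne
  · refine ⟨0, 0, 0, ⟨Subsingleton.elim _ _, fun _ _ i => i.elim0⟩,
      ⟨?_, fun _ _ x => hempty.elim x⟩, fun f _ => ?_⟩
    · ext x
      exact hempty.elim x
    · exact (ContinuousMap.norm_lt_iff _ hε).2 fun x => hempty.elim x
  obtain ⟨n, f, -, rfl⟩ := hF.fin_param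
  obtain ⟨m, x, hx⟩ := exists_finite_net f (half_pos hε)
  -- The functions and their negatives give the two halves of the estimate.
  obtain ⟨h, hpos, hone, hlt⟩ := hΔ.exists_affine_partition x (Sum.elim f (-f)) (half_lt_self hε)
    fun y => by
      obtain ⟨i, hi⟩ := hx y
      refine ⟨i, ?_⟩
      rintro (j | j)
      · have := (abs_lt.1 (hi j)).2
        simp only [Sum.elim_inl]
        linarith
      · have := (abs_lt.1 (hi j)).1
        change -(f j : C(Δ, ℝ)) y - ε / 2 ≤ -(f j : C(Δ, ℝ)) (x i)
        linarith
  refine ⟨m, LinearMap.pi fun i => Aff.eval (x i), Fintype.linearCombination ℝ h,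
    ⟨?_, fun g hg i => hg (x i)⟩, ⟨?_, fun v hv y => ?_⟩, ?_⟩
  · funext i
    rfl
  · simp [Fintype.linearCombination_apply, hone]
  · rw [Fintype.linearCombination_apply, Aff.sum_apply]
    exact Finset.sum_nonneg fun i _ => mul_nonneg (hv i) (hpos i y)
  · rintro _ ⟨j, rfl⟩
    refine (ContinuousMap.norm_lt_iff _ hε).2 fun y => ?_
    have h₁ := hlt (Sum.inl j) y
    have h₂ := hlt (Sum.inr j) y
    have h₃ : ∀ z, ((-f j : Aff Δ) : C(Δ, ℝ)) z = -(f j : C(Δ, ℝ)) z := fun _ => rfl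
    simp only [Sum.elim_inl, Sum.elim_inr, Pi.neg_apply, h₃, neg_mul,
      Finset.sum_neg_distrib] at h₁ h₂
    have h₄ : ((∑ i, (LinearMap.pi (fun i => Aff.eval (x i)) (f j) i) • h i - f j : Aff Δ) :
        C(Δ, ℝ)) y = ∑ i, (f j : C(Δ, ℝ)) (x i) * (h i : C(Δ, ℝ)) y - (f j : C(Δ, ℝ)) y := by
      rw [← Aff.eval_apply, map_sub, map_sum]
      rfl
    have h₅ : |∑ i, (f j : C(Δ, ℝ)) (x i) * (h i : C(Δ, ℝ)) y - (f j : C(Δ, ℝ)) y| < ε :=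
      abs_lt.2 ⟨by linarith, by linarith⟩
    rw [← h₄] at h₅
    exact h₅
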